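/- Let $D$ be a metric space that is uniformly discrete (there is $\varepsilon>0$ with $d(x,y)\ge\varepsilon$ for all $x\ne y$ in $D$) and has bounded geometry (for every $R>0$ the number of points in the balls of radius $R$ is uniformly bounded). Suppose that $D$ satisfies at least one of the following two conditions: 1. there is $\alpha>0$ such that the graph $D(\alpha)$, whose vertices are the points of $D$ and in which two distinct points $x,y$ are joined by an edge if and only if $d(x,y)\le\alpha$, has no finite connected components; 2. there are a discrete proper metric space $D'$ with a ray structure, and an isometric inclusion $D\subset D'$ which is a coarse equivalence, i.e. there is $C>0$ such that every $x\in D'$ satisfies $d(x,y)<C$ for some $y\in D$. (Proper means that all closed balls are compact. A ray structure on $D'$ is a partition $D'=\bigsqcup_{i\in I}D'_i$ together with bijections $\beta_i:\mathbb N\to D'_i$, $i\in I$, that are Lipschitz with a common constant.) For a complex Hilbert space $H$ let $C^*_H(D)$ be the Roe algebra: the norm closure in $\mathbb B(\ell^2(D)\otimes H)$ of the $*$-algebra of all operators $T$ that are locally compact ($Tf$ and $fT$ are compact for every $f\in C_0(D)$, acting by multiplication) and have finite propagation (for some $R>0$, $fTg=0$ whenever $f,g\in C_0(D)$ have supports at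 distance greater than $R$). For $H=\mathbb C$ this is the uniform Roe algebra $C^*_{\mathbb C}(D)$, which is unital. Let $H$ be an infinite-dimensional complex Hilbert space, let $V:\mathbb C\to H$ be an isometry, set $V_D=\mathrm{id}\otimes V:\ell^2(D)\to\ell^2(D)\otimes H$, and let $i_D:C^*_{\mathbb C}(D)\to C^*_H(D)$ be the $*$-homomorphism $i_D(T)=V_DTV_D^*$. Then the induced map $(i_D)_*:K_0(C^*_{\mathbb C}(D))\to K_0(C^*_H(D))$ satisfies $$(i_D)_*([1])=0 .$$ -/

import Mathlib

open scoped Matrix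

namespace CoarseK

section KTheory

/-- Murray--von Neumann equivalence of square matrices `p`, `q` (of possibly different sizes) over
a star ring: there is a rectangular `v` with `v* v = p` and `v v* = q`. -/
def MvN {A : Type*} [Ring A] [StarRing A] {m n : Type*} [Fintype m] [Fintype n]
    (p : Matrix m m A) (q : Matrix n n A) : Prop :=
  ∃ v : Matrix n m A, vᴴ * v = p ∧ v * vᴴ = q

theorem MvN.refl {A : Type*} [Ring A] [StarRing A] {m : Type*} [Fintype m]
    {p : Matrix m m A} (hp : IsStarProjection p) : MvN p p := by
  have h1 : pᴴ = p := hp.isSelfAdjoint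
  have h2 : p * p = p := hp.isIdempotentElem
  exact ⟨p, by rw [h1, h2], by rw [h1, h2]⟩

theorem MvN.symm {A : Type*} [Ring A] [StarRing A] {m n : Type*} [Fintype m] [Fintype n]
    {p : Matrix m m A} {q : Matrix n n A} (h : MvN p q) : MvN q p := by
  obtain ⟨v, h1, h2⟩ := h
  exact ⟨vᴴ, by simpa using h2, by simpa using h1⟩

theorem MvN.trans {A : Type*} [Ring A] [StarRing A] {l m n : Type*} [Fintype l] [Fintype m]
    [Fintype n] {p : Matrix l l A} {q : Matrix m m A} {r : Matrix n n A}
    (hp : IsStarProjection p) (hr : IsStarProjection r) (h : MvN p q) (h' : MvN q r) :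
    MvN p r := by
  obtain ⟨v, h1, h2⟩ := h
  obtain ⟨w, h3, h4⟩ := h'
  have hp2 : p * p = p := hp.isIdempotentElem
  have hr2 : r * r = r := hr.isIdempotentElem
  refine ⟨w * v, ?_, ?_⟩
  · calc (w * v)ᴴ * (w * v) = vᴴ * (wᴴ * w) * v := by
          simp only [Matrix.conjTranspose_mul, Matrix.mul_assoc]
      _ = (vᴴ * v) * (vᴴ * v) := by rw [h3, ← h2]; simp only [Matrix.mul_assoc]
      _ = p := by rw [h1, hp2]
  · calc (w * v) * (w * v)ᴴ = w * (v * vᴴ) * wᴴ := by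
          simp only [Matrix.conjTranspose_mul, Matrix.mul_assoc]
      _ = (w * wᴴ) * (w * wᴴ) := by rw [h2, ← h3]; simp only [Matrix.mul_assoc]
      _ = r := by rw [h4, hr2]

theorem MvN.blocks {A : Type*} [Ring A] [StarRing A] {m n m' n' : Type*} [Fintype m] [Fintype n]
    [Fintype m'] [Fintype n'] {p : Matrix m m A} {q : Matrix n n A} {p' : Matrix m' m' A}
    {q' : Matrix n' n' A} (h : MvN p q) (h' : MvN p' q') :
    MvN (Matrix.fromBlocks p 0 0 p') (Matrix.fromBlocks q 0 0 q') := by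
  obtain ⟨v, h1, h2⟩ := h
  obtain ⟨w, h3, h4⟩ := h'
  refine ⟨Matrix.fromBlocks v 0 0 w, ?_, ?_⟩ <;>
    simp [Matrix.fromBlocks_conjTranspose, Matrix.fromBlocks_multiply, h1, h2, h3, h4]

theorem MvN.submatrix {A : Type*} [Ring A] [StarRing A] {m n : Type*} [Fintype m] [Fintype n]
    {p : Matrix m m A} (hp : IsStarProjection p) (e : n ≃ m) : MvN p (p.submatrix e e) := by
  have h1 : pᴴ = p := hp.isSelfAdjoint
  have h2 : p * p = p := hp.isIdempotentElem
  refine ⟨p.submatrix e id, ?_, ?_⟩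
  · rw [Matrix.conjTranspose_submatrix, h1, Matrix.submatrix_mul_equiv, h2, Matrix.submatrix_id_id]
  · rw [Matrix.conjTranspose_submatrix, h1,
      ← Matrix.submatrix_mul p p e id e Function.bijective_id, h2]

theorem isStarProjection_blocks {A : Type*} [Ring A] [StarRing A] {m n : Type*} [Fintype m]
    [Fintype n] {p : Matrix m m A} {q : Matrix n n A} (hp : IsStarProjection p)
    (hq : IsStarProjection q) : IsStarProjection (Matrix.fromBlocks p 0 0 q) := by
  have h1 : pᴴ = p := hp.isSelfAdjoint
  have h2 : p * p = p := hp.isIdempotentElem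
  have h3 : qᴴ = q := hq.isSelfAdjoint
  have h4 : q * q = q := hq.isIdempotentElem
  constructor
  · simp [IsIdempotentElem, Matrix.fromBlocks_multiply, h2, h4]
  · simp [IsSelfAdjoint, Matrix.star_eq_conjTranspose, Matrix.fromBlocks_conjTranspose, h1, h3]

theorem isStarProjection_submatrix {A : Type*} [Ring A] [StarRing A] {m n : Type*} [Fintype m]
    [Fintype n] {p : Matrix m m A} (hp : IsStarProjection p) (e : n ≃ m) :
    IsStarProjection (p.submatrix e e) := by
  have h1 : pᴴ = p := hp.isSelfAdjoint
  have h2 : p * p = p := hp.isIdempotentElem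
  constructor
  · rw [IsIdempotentElem, Matrix.submatrix_mul_equiv, h2]
  · rw [IsSelfAdjoint, Matrix.star_eq_conjTranspose, Matrix.conjTranspose_submatrix, h1]

theorem conjTranspose_map_hom {A B : Type*} [Ring A] [StarRing A] [Algebra ℂ A]
    [Ring B] [StarRing B] [Algebra ℂ B] (φ : A →⋆ₐ[ℂ] B) {m n : Type*} (v : Matrix m n A) :
    (v.map φ)ᴴ = vᴴ.map φ := by
  ext i j
  exact (map_star φ (v j i)).symm

theorem isStarProjection_map {A B : Type*} [Ring A] [StarRing A] [Algebra ℂ A]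
    [Ring B] [StarRing B] [Algebra ℂ B] (φ : A →⋆ₐ[ℂ] B) {m : Type*} [Fintype m]
    {p : Matrix m m A} (hp : IsStarProjection p) : IsStarProjection (p.map φ) := by
  have h1 : pᴴ = p := hp.isSelfAdjoint
  have h2 : p * p = p := hp.isIdempotentElem
  constructor
  · rw [IsIdempotentElem, ← Matrix.map_mul, h2]
  · rw [IsSelfAdjoint, Matrix.star_eq_conjTranspose, conjTranspose_map_hom, h1]

/-- The projections in the matrix algebras `M_n(A)`, `n = 0, 1, 2, …`. -/
structure MatProj (A : Type*) [Ring A] [StarRing A] where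
  size : ℕ
  mat : Matrix (Fin size) (Fin size) A
  isProj : IsStarProjection mat

/-- Murray--von Neumann equivalence on `⋃ₙ Proj M_n(A)`. -/
instance MatProj.setoid (A : Type*) [Ring A] [StarRing A] : Setoid (MatProj A) where
  r p q := MvN p.mat q.mat
  iseqv := ⟨fun p => MvN.refl p.isProj, fun h => h.symm,
    fun {p _ r} h h' => MvN.trans p.isProj r.isProj h h'⟩

/-- The block diagonal sum `p ⊕ q`. -/
def MatProj.sum {A : Type*} [Ring A] [StarRing A] (p q : MatProj A) : MatProj A where
  size := p.size + q.size
  mat := (Matrix.fromBlocks p.mat 0 0 q.mat).submatrix finSumFinEquiv.symm finSumFinEquiv.symm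
  isProj := isStarProjection_submatrix (isStarProjection_blocks p.isProj q.isProj) _

theorem MatProj.sum_mvn {A : Type*} [Ring A] [StarRing A] (p q : MatProj A) :
    MvN (Matrix.fromBlocks p.mat 0 0 q.mat) (p.sum q).mat :=
  MvN.submatrix (isStarProjection_blocks p.isProj q.isProj) _

/-- The zero projection, of size `0`. -/
def MatProj.zero (A : Type*) [Ring A] [StarRing A] : MatProj A where
  size := 0
  mat := 0
  isProj := IsStarProjection.zero _

/-- The image of a projection under a unital `*`-homomorphism, applied entrywise. -/
def MatProj.map {A B : Type*} [Ring A] [StarRing A] [Algebra ℂ A]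
    [Ring B] [StarRing B] [Algebra ℂ B] (φ : A →⋆ₐ[ℂ] B) (p : MatProj A) : MatProj B where
  size := p.size
  mat := p.mat.map φ
  isProj := isStarProjection_map φ p.isProj

/-- The semigroup `V(A)` of Murray--von Neumann classes of projections over `A`. -/
def VMon (A : Type*) [Ring A] [StarRing A] : Type _ := Quotient (MatProj.setoid A)

/-- The class of a projection in `V(A)`. -/
def VMon.mk {A : Type*} [Ring A] [StarRing A] (p : MatProj A) : VMon A :=
  Quotient.mk (MatProj.setoid A) p

theorem VMon.sound {A : Type*} [Ring A] [StarRing A] {p q : MatProj A}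
    (h : MvN p.mat q.mat) : VMon.mk p = VMon.mk q :=
  Quotient.sound h

theorem MatProj.sum_congr {A : Type*} [Ring A] [StarRing A] {p q p' q' : MatProj A}
    (h : MvN p.mat p'.mat) (h' : MvN q.mat q'.mat) : MvN (p.sum q).mat (p'.sum q').mat := by
  have hb := isStarProjection_blocks p.isProj q.isProj
  have hb' := isStarProjection_blocks p'.isProj q'.isProj
  exact MvN.trans (p.sum q).isProj (p'.sum q').isProj (MvN.symm (p.sum_mvn q))
    (MvN.trans hb (p'.sum q').isProj (h.blocks h') (p'.sum_mvn q'))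

/-- Addition on `V(A)` is induced by the block diagonal sum. -/
instance VMon.instAdd (A : Type*) [Ring A] [StarRing A] : Add (VMon A) where
  add := Quotient.map₂ MatProj.sum (fun _ _ h _ _ h' => MatProj.sum_congr h h')

instance VMon.instZero (A : Type*) [Ring A] [StarRing A] : Zero (VMon A) where
  zero := VMon.mk (MatProj.zero A)

instance VMon.instAddCommMonoid (A : Type*) [Ring A] [StarRing A] : AddCommMonoid (VMon A) where
  nsmul := nsmulRec
  add_assoc := by
    rintro ⟨p⟩ ⟨q⟩ ⟨r⟩
    refine VMon.sound (p := (p.sum q).sum r) (q := p.sum (q.sum r)) ?_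
    have hp := p.isProj
    have hq := q.isProj
    have hr := r.isProj
    have h1 : MvN (Matrix.fromBlocks (Matrix.fromBlocks p.mat 0 0 q.mat) 0 0 r.mat)
        ((p.sum q).sum r).mat :=
      MvN.trans (isStarProjection_blocks (isStarProjection_blocks hp hq) hr) (MatProj.isProj _)
        (MvN.blocks (p.sum_mvn q) (MvN.refl hr)) ((p.sum q).sum_mvn r)
    have h2 : MvN (Matrix.fromBlocks p.mat 0 0 (Matrix.fromBlocks q.mat 0 0 r.mat))
        (p.sum (q.sum r)).mat :=
      MvN.trans (isStarProjection_blocks hp (isStarProjection_blocks hq hr)) (MatProj.isProj _)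
        (MvN.blocks (MvN.refl hp) (q.sum_mvn r)) (p.sum_mvn (q.sum r))
    have h3 := MvN.submatrix
      (isStarProjection_blocks hp (isStarProjection_blocks hq hr)) (Equiv.sumAssoc _ _ _)
    have h4 : (Matrix.fromBlocks p.mat 0 0 (Matrix.fromBlocks q.mat 0 0 r.mat)).submatrix
        (Equiv.sumAssoc _ _ _) (Equiv.sumAssoc _ _ _) =
        Matrix.fromBlocks (Matrix.fromBlocks p.mat 0 0 q.mat) 0 0 r.mat := by
      ext ((i | i) | i) ((j | j) | j) <;> simp
    rw [h4] at h3
    exact MvN.trans (MatProj.isProj _) (MatProj.isProj _) h1.symm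
      (MvN.trans (isStarProjection_blocks (isStarProjection_blocks hp hq) hr)
        (MatProj.isProj _) h3.symm h2)
  zero_add := by
    rintro ⟨p⟩
    refine VMon.sound (p := (MatProj.zero A).sum p) (q := p) ?_
    have h3 := MvN.submatrix
      (isStarProjection_blocks (MatProj.zero A).isProj p.isProj) (Equiv.emptySum (Fin 0) _).symm
    have h4 : (Matrix.fromBlocks (MatProj.zero A).mat 0 0 p.mat).submatrix
        (Equiv.emptySum (Fin 0) _).symm (Equiv.emptySum (Fin 0) _).symm = p.mat := by
      rfl
    exact MvN.trans (MatProj.isProj _) p.isProj ((MatProj.zero A).sum_mvn p).symm (h4 ▸ h3)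
  add_zero := by
    rintro ⟨p⟩
    refine VMon.sound (p := p.sum (MatProj.zero A)) (q := p) ?_
    have h3 := MvN.submatrix
      (isStarProjection_blocks p.isProj (MatProj.zero A).isProj) (Equiv.sumEmpty _ (Fin 0)).symm
    have h4 : (Matrix.fromBlocks p.mat 0 0 (MatProj.zero A).mat).submatrix
        (Equiv.sumEmpty _ (Fin 0)).symm (Equiv.sumEmpty _ (Fin 0)).symm = p.mat := by
      rfl
    exact MvN.trans (MatProj.isProj _) p.isProj (p.sum_mvn (MatProj.zero A)).symm (h4 ▸ h3)
  add_comm := by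
    rintro ⟨p⟩ ⟨q⟩
    refine VMon.sound (p := p.sum q) (q := q.sum p) ?_
    have h3 := MvN.submatrix
      (isStarProjection_blocks p.isProj q.isProj) (Equiv.sumComm _ _)
    have h4 : (Matrix.fromBlocks p.mat 0 0 q.mat).submatrix
        (Equiv.sumComm _ _) (Equiv.sumComm _ _) = Matrix.fromBlocks q.mat 0 0 p.mat := by
      ext (i | i) (j | j) <;> simp
    rw [h4] at h3
    exact MvN.trans (MatProj.isProj _) (MatProj.isProj _) (p.sum_mvn q).symm
      (MvN.trans (isStarProjection_blocks p.isProj q.isProj) (MatProj.isProj _) h3 (q.sum_mvn p))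

/-- Functoriality of `V`. -/
def VMon.map {A B : Type*} [Ring A] [StarRing A] [Algebra ℂ A]
    [Ring B] [StarRing B] [Algebra ℂ B] (φ : A →⋆ₐ[ℂ] B) : VMon A →+ VMon B where
  toFun := Quotient.map (MatProj.map φ) (by
    rintro p q ⟨v, h1, h2⟩
    refine ⟨v.map φ, ?_, ?_⟩
    · change (v.map φ)ᴴ * v.map φ = p.mat.map φ
      rw [conjTranspose_map_hom, ← Matrix.map_mul, h1]
    · change v.map φ * (v.map φ)ᴴ = q.mat.map φ
      rw [conjTranspose_map_hom, ← Matrix.map_mul, h2])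
  map_zero' := by
    refine VMon.sound (p := (MatProj.zero A).map φ) (q := MatProj.zero B) ⟨0, ?_, ?_⟩ <;>
      · ext i
        exact Fin.elim0 i
  map_add' := by
    rintro ⟨p⟩ ⟨q⟩
    refine congrArg VMon.mk (?_ : (p.sum q).map φ = (p.map φ).sum (q.map φ))
    have h : ((Matrix.fromBlocks p.mat 0 0 q.mat).submatrix finSumFinEquiv.symm
        finSumFinEquiv.symm).map φ = (Matrix.fromBlocks (p.mat.map φ) 0 0 (q.mat.map φ)).submatrix
        finSumFinEquiv.symm finSumFinEquiv.symm := by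
      rw [← Matrix.submatrix_map, Matrix.fromBlocks_map]
      simp [Matrix.map_zero]
    simp only [MatProj.map, MatProj.sum, h]
    rfl

/-- For a unital algebra `A`, the Grothendieck group `K₀₀(A)` of `V(A)`. -/
abbrev K00 (A : Type*) [Ring A] [StarRing A] : Type _ := Algebra.GrothendieckAddGroup (VMon A)

/-- Functoriality of `K₀₀` for unital `*`-homomorphisms. -/
noncomputable def K00.map {A B : Type*} [Ring A] [StarRing A] [Algebra ℂ A]
    [Ring B] [StarRing B] [Algebra ℂ B] (φ : A →⋆ₐ[ℂ] B) : K00 A →+ K00 B :=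
  Algebra.GrothendieckAddGroup.lift (Algebra.GrothendieckAddGroup.of.comp (VMon.map φ))

theorem K00.map_of {A B : Type*} [Ring A] [StarRing A] [Algebra ℂ A]
    [Ring B] [StarRing B] [Algebra ℂ B] (φ : A →⋆ₐ[ℂ] B) (x : VMon A) :
    K00.map φ (Algebra.GrothendieckAddGroup.of x) =
      Algebra.GrothendieckAddGroup.of (VMon.map φ x) :=
  DFunLike.congr_fun (Algebra.GrothendieckAddGroup.lift.left_inv
    (Algebra.GrothendieckAddGroup.of.comp (VMon.map φ))) x

theorem K00.map_comp {A B C : Type*} [Ring A] [StarRing A] [Algebra ℂ A]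
    [Ring B] [StarRing B] [Algebra ℂ B] [Ring C] [StarRing C] [Algebra ℂ C]
    (ψ : B →⋆ₐ[ℂ] C) (φ : A →⋆ₐ[ℂ] B) (x : K00 A) :
    K00.map ψ (K00.map φ x) = K00.map (ψ.comp φ) x := by
  have h : (K00.map ψ).comp (K00.map φ) = K00.map (ψ.comp φ) := by
    apply Algebra.GrothendieckAddGroup.lift.symm.injective
    ext y
    change K00.map ψ (K00.map φ (Algebra.GrothendieckAddGroup.of y)) =
      K00.map (ψ.comp φ) (Algebra.GrothendieckAddGroup.of y)
    rw [K00.map_of, K00.map_of, K00.map_of]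
    obtain ⟨p⟩ := y
    rfl
  exact DFunLike.congr_fun h x

/-- The `*`-homomorphism `A~ → ℂ` from the unitization with kernel `A`. -/
def augmentation (A : Type*) [NonUnitalRing A] [StarRing A] [Module ℂ A] [IsScalarTower ℂ A A]
    [SMulCommClass ℂ A A] [StarModule ℂ A] : Unitization ℂ A →⋆ₐ[ℂ] ℂ :=
  { Unitization.fstHom ℂ A with map_star' := fun _ => rfl }

/-- The group `K₀(A)` of a not necessarily unital `C*`-algebra:
the kernel of `K₀₀(A~) → K₀₀(ℂ)`. -/
def K0 (A : Type*) [NonUnitalRing A] [StarRing A] [Module ℂ A] [IsScalarTower ℂ A A]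
    [SMulCommClass ℂ A A] [StarModule ℂ A] : Type _ :=
  (K00.map (augmentation A)).ker

noncomputable instance K0.instAddCommGroup (A : Type*) [NonUnitalRing A] [StarRing A] [Module ℂ A]
    [IsScalarTower ℂ A A] [SMulCommClass ℂ A A] [StarModule ℂ A] : AddCommGroup (K0 A) :=
  inferInstanceAs (AddCommGroup (K00.map (augmentation A)).ker)

theorem augmentation_comp {A B : Type*}
    [NonUnitalRing A] [StarRing A] [Module ℂ A] [IsScalarTower ℂ A A] [SMulCommClass ℂ A A]
    [StarModule ℂ A] [NonUnitalRing B] [StarRing B] [Module ℂ B] [IsScalarTower ℂ B B]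
    [SMulCommClass ℂ B B] [StarModule ℂ B] (φ : A →⋆ₙₐ[ℂ] B) :
    (augmentation B).comp (Unitization.starMap φ) = augmentation A := by
  ext a
  change (Unitization.starMap φ (Unitization.inr a)).fst = (Unitization.inr a : Unitization ℂ A).fst
  simp

/-- The homomorphism `φ_* : K₀(A) → K₀(B)` induced by a `*`-homomorphism `φ : A → B`. -/
noncomputable def K0.map {A B : Type*}
    [NonUnitalRing A] [StarRing A] [Module ℂ A] [IsScalarTower ℂ A A] [SMulCommClass ℂ A A]
    [StarModule ℂ A] [NonUnitalRing B] [StarRing B] [Module ℂ B] [IsScalarTower ℂ B B]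
    [SMulCommClass ℂ B B] [StarModule ℂ B] (φ : A →⋆ₙₐ[ℂ] B) : K0 A →+ K0 B :=
  ((K00.map (Unitization.starMap φ)).comp (K00.map (augmentation A)).ker.subtype).codRestrict
    (K00.map (augmentation B)).ker (fun x => by
    have hx : K00.map (augmentation A) x = 0 := x.2
    change K00.map (augmentation B) (K00.map (Unitization.starMap φ) x) = 0
    rw [K00.map_comp, augmentation_comp, hx])

/-- A projection of `A`, seen as a `1 × 1` matrix over the unitization `A~`. -/
def MatProj.ofProj {A : Type*} [NonUnitalRing A] [StarRing A] [Module ℂ A] [IsScalarTower ℂ A A]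
    [SMulCommClass ℂ A A] [StarModule ℂ A] (p : A) (hp : IsStarProjection p) :
    MatProj (Unitization ℂ A) where
  size := 1
  mat := Matrix.of fun _ _ => (p : Unitization ℂ A)
  isProj := by
    have h1 : star p = p := hp.isSelfAdjoint
    have h2 : p * p = p := hp.isIdempotentElem
    constructor
    · refine Matrix.ext fun i j => ?_
      rw [Matrix.mul_apply]
      simp [← Unitization.inr_mul, h2]
    · refine Matrix.ext fun i j => ?_
      rw [Matrix.star_apply]
      simp [← Unitization.inr_star, h1]

/-- The class `[p] ∈ K₀(A)` of a projection `p ∈ A`. -/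
noncomputable def K0.cls {A : Type*} [NonUnitalRing A] [StarRing A] [Module ℂ A]
    [IsScalarTower ℂ A A] [SMulCommClass ℂ A A] [StarModule ℂ A] (p : A)
    (hp : IsStarProjection p) : K0 A :=
  ⟨Algebra.GrothendieckAddGroup.of (VMon.mk (MatProj.ofProj p hp)), by
    change K00.map (augmentation A) _ = 0
    rw [K00.map_of]
    have h : VMon.map (augmentation A) (VMon.mk (MatProj.ofProj p hp)) = 0 := by
      have h0 : ((MatProj.ofProj p hp).map (augmentation A)).mat = 0 := by
        ext i j
        rfl
      refine VMon.sound (p := (MatProj.ofProj p hp).map (augmentation A))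
        (q := MatProj.zero ℂ) ⟨0, ?_, ?_⟩
      · rw [h0, Matrix.mul_zero]
      · ext i
        exact Fin.elim0 i
    rw [h, map_zero]⟩

end KTheory

section Geometry

/-- Uniform discreteness: distinct points have distance at least some `ε > 0`. -/
class UniformlyDiscrete (D : Type*) [MetricSpace D] : Prop where
  exists_le_dist : ∃ ε : ℝ, 0 < ε ∧ ∀ x y : D, x ≠ y → ε ≤ dist x y

instance UniformlyDiscrete.discreteTopology (D : Type*) [MetricSpace D] [UniformlyDiscrete D] :
    DiscreteTopology D := by
  obtain ⟨ε, hε, h⟩ := UniformlyDiscrete.exists_le_dist (D := D)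
  exact DiscreteTopology.of_forall_le_dist hε fun x y hxy => h x y hxy

/-- Bounded geometry of a discrete space: for every `R > 0` the number of points in the balls of
radius `R` is uniformly bounded. -/
def BoundedGeometry (D : Type*) [MetricSpace D] : Prop :=
  ∀ R : ℝ, 0 < R → ∃ N : ℕ, ∀ x : D, (Metric.closedBall x R).encard ≤ N

/-- The graph `D(α)`: the vertices are the points of `D`, and two distinct points are adjacent
if and only if their distance is at most `α`. -/
def ripsGraph (D : Type*) [MetricSpace D] (α : ℝ) : SimpleGraph D where
  Adj x y := x ≠ y ∧ dist x y ≤ α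
  symm := ⟨fun x y h => ⟨h.1.symm, by rw [dist_comm]; exact h.2⟩⟩
  loopless := ⟨fun _ h => h.1 rfl⟩

/-- For some `α > 0`, the graph `D(α)` has no finite connected components. -/
def NoFiniteComponents (D : Type*) [MetricSpace D] : Prop :=
  ∃ α : ℝ, 0 < α ∧ ∀ c : (ripsGraph D α).ConnectedComponent, ¬ c.supp.Finite

universe u v

/-- A ray structure on `D`: a partition of `D` into subsets `S i` together with uniformly
Lipschitz bijections `β i : ℕ → S i`. -/
def HasRayStructure (D : Type v) [MetricSpace D] : Prop :=
  ∃ (I : Type v) (S : I → Set D) (β : I → ℕ → D),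
    (⋃ i, S i) = Set.univ ∧ Pairwise (fun i j => Disjoint (S i) (S j)) ∧
    (∀ i, Set.BijOn (β i) Set.univ (S i)) ∧ ∃ L : NNReal, ∀ i, LipschitzWith L (β i)

/-- `D` embeds isometrically and coarsely densely into a discrete proper metric space
with a ray structure. -/
def EmbedsInRaySpace (D : Type u) [MetricSpace D] : Prop :=
  ∃ (D' : Type v) (_ : MetricSpace D'), DiscreteTopology D' ∧ ProperSpace D' ∧
    HasRayStructure D' ∧ ∃ j : D → D', Isometry j ∧
      ∃ C : ℝ, 0 < C ∧ ∀ x : D', ∃ y : D, dist x (j y) < C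

end Geometry

section Roe

open scoped ZeroAtInfty ComplexInnerProductSpace

/-- The Hilbert space `ℓ²(D) ⊗ H`, realized as the space `ℓ²(D; H)` of square summable
functions `D → H`. -/
abbrev L2 (D : Type*) (H : Type*) [NormedAddCommGroup H] : Type _ := lp (fun _ : D => H) 2

/-- The operator of multiplication by `f ∈ C₀(D)` on `ℓ²(D; H)`. -/
noncomputable def mulOp {D : Type*} [MetricSpace D] {H : Type*} [NormedAddCommGroup H]
    [InnerProductSpace ℂ H] (f : C₀(D, ℂ)) : L2 D H →L[ℂ] L2 D H :=
  lp.mapCLM 2 (fun x => f x • ContinuousLinearMap.id ℂ H) (norm_nonneg f.toBCF) (fun x =>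
    (norm_smul_le _ _).trans ((mul_le_of_le_one_right (norm_nonneg _)
      ContinuousLinearMap.norm_id_le).trans (f.toBCF.norm_coe_le_norm x)))

@[simp]
theorem mulOp_apply {D : Type*} [MetricSpace D] {H : Type*} [NormedAddCommGroup H]
    [InnerProductSpace ℂ H] (f : C₀(D, ℂ)) (ξ : L2 D H) (x : D) :
    mulOp f ξ x = f x • ξ x := rfl

/-- `T` is locally compact: `T f` and `f T` are compact for every `f ∈ C₀(D)`. -/
def IsLocallyCompactOp {D : Type*} [MetricSpace D] {H : Type*} [NormedAddCommGroup H]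
    [InnerProductSpace ℂ H] (T : L2 D H →L[ℂ] L2 D H) : Prop :=
  ∀ f : C₀(D, ℂ), IsCompactOperator (T * mulOp f : L2 D H →L[ℂ] L2 D H) ∧
    IsCompactOperator (mulOp f * T : L2 D H →L[ℂ] L2 D H)

/-- `T` has finite propagation: for some `R > 0`, `f T g = 0` for all `f, g ∈ C₀(D)` whose supports
are at distance greater than `R`. -/
def HasFinitePropagation {D : Type*} [MetricSpace D] {H : Type*} [NormedAddCommGroup H]
    [InnerProductSpace ℂ H] (T : L2 D H →L[ℂ] L2 D H) : Prop :=
  ∃ R : ℝ, 0 < R ∧ ∀ f g : C₀(D, ℂ),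
    (∀ x ∈ tsupport f, ∀ y ∈ tsupport g, R < dist x y) → mulOp f * T * mulOp g = 0

theorem mulOp_adjoint {D : Type*} [MetricSpace D] {H : Type*} [NormedAddCommGroup H]
    [InnerProductSpace ℂ H] [CompleteSpace H] (f : C₀(D, ℂ)) :
    star (mulOp f : L2 D H →L[ℂ] L2 D H) = mulOp (star f) := by
  rw [ContinuousLinearMap.star_eq_adjoint, eq_comm, ContinuousLinearMap.eq_adjoint_iff]
  intro ξ η
  rw [lp.inner_eq_tsum, lp.inner_eq_tsum]
  refine tsum_congr fun x => ?_
  simp [inner_smul_left, inner_smul_right]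

/-- The adjoint of a compact operator between Hilbert spaces is compact. -/
theorem isCompactOperator_adjoint {E F : Type*} [NormedAddCommGroup E] [InnerProductSpace ℂ E]
    [CompleteSpace E] [NormedAddCommGroup F] [InnerProductSpace ℂ F] [CompleteSpace F]
    {T : E →L[ℂ] F} (hT : IsCompactOperator T) :
    IsCompactOperator (ContinuousLinearMap.adjoint T) := by
  set S := ContinuousLinearMap.adjoint T with hS
  have hTS : IsCompactOperator (T ∘L S) := hT.comp_clm S
  have h1 : TotallyBounded ((T ∘L S) '' Metric.closedBall 0 1) :=
    (hTS.isCompact_closure_image_closedBall (f := ((T ∘L S : F →L[ℂ] F) : F →ₗ[ℂ] F))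
      1).totallyBounded.subset subset_closure
  have h2 : TotallyBounded (S '' Metric.closedBall 0 1) := by
    rw [Metric.totallyBounded_iff]
    intro ε hε
    obtain ⟨t, hts, htf, hcov⟩ := Metric.finite_approx_of_totallyBounded h1 (ε ^ 2 / 2) (by positivity)
    obtain ⟨t0, ht0, ht0f, rfl⟩ := Set.exists_subset_image_finite_and.1 ⟨t, hts, htf, rfl⟩
    refine ⟨S '' t0, ht0f.image _, ?_⟩
    rintro _ ⟨x, hx, rfl⟩
    obtain ⟨y, hy, hxy⟩ : ∃ y ∈ t0, ‖T (S (x - y))‖ < ε ^ 2 / 2 := by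
      have := hcov ⟨x, hx, rfl⟩
      simp only [Set.mem_iUnion, Set.mem_image, Metric.mem_ball] at this
      obtain ⟨_, ⟨y, hy, rfl⟩, h⟩ := this
      refine ⟨y, hy, ?_⟩
      rw [map_sub, map_sub, ← dist_eq_norm]
      exact h
    simp only [Set.mem_iUnion, Set.mem_image, Metric.mem_ball]
    refine ⟨S y, ⟨y, hy, rfl⟩, ?_⟩
    have hy1 := ht0 hy
    rw [mem_closedBall_zero_iff] at hx hy1
    have hn : ‖x - y‖ ≤ 2 := (norm_sub_le x y).trans (by linarith)
    have h3 : ‖S (x - y)‖ ^ 2 ≤ ‖T (S (x - y))‖ * 2 := by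
      have h4 : ⟪S (x - y), S (x - y)⟫ = ⟪T (S (x - y)), x - y⟫ :=
        ContinuousLinearMap.adjoint_inner_right T _ _
      have h5 : ‖S (x - y)‖ ^ 2 = ‖⟪S (x - y), S (x - y)⟫‖ := by
        rw [inner_self_eq_norm_sq_to_K]
        simp
      rw [h5, h4]
      exact (norm_inner_le_norm _ _).trans (by gcongr)
    rw [dist_eq_norm, ← map_sub]
    nlinarith [norm_nonneg (S (x - y))]
  refine (isCompactOperator_iff_isCompact_closure_image_closedBall
    (S : F →ₗ[ℂ] E) one_pos).2 ?_
  exact isCompact_iff_totallyBounded_isComplete.2 ⟨h2.closure, isClosed_closure.isComplete⟩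

section

variable {D : Type*} [MetricSpace D] [DiscreteTopology D]

/-- The indicator function of a point, as an element of `C₀(D)`. -/
noncomputable def pointFun (x : D) : C₀(D, ℂ) where
  toFun := Set.indicator {x} 1
  continuous_toFun := continuous_of_discreteTopology
  zero_at_infty' := by
    refine tendsto_const_nhds.congr' ?_
    filter_upwards [(isCompact_singleton (x := x)).compl_mem_cocompact] with y hy
    exact (Set.indicator_of_notMem hy _).symm

end

theorem finitePropagation_iff {D : Type*} [MetricSpace D] [DiscreteTopology D] {H : Type*}
    [NormedAddCommGroup H] [InnerProductSpace ℂ H] (T : L2 D H →L[ℂ] L2 D H) :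
    HasFinitePropagation T ↔ ∃ R : ℝ, 0 < R ∧ ∀ (ξ : L2 D H) (x : D),
      (∀ y, dist x y ≤ R → ξ y = 0) → T ξ x = 0 := by
  classical
  constructor
  · rintro ⟨R, hR, h⟩
    refine ⟨R, hR, fun ξ x hξ => ?_⟩
    have key : ∀ y, T (lp.single 2 y (ξ y)) x = 0 := by
      intro y
      by_cases hxy : dist x y ≤ R
      · rw [hξ y hxy, lp.single_zero, map_zero]
        rfl
      · have h1 := h (pointFun x) (pointFun y) (by
          intro a ha b hb
          have ha' : a = x := by
            rw [tsupport, closure_discrete] at ha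
            by_contra hne
            exact ha (Set.indicator_of_notMem (s := {x}) hne 1)
          have hb' : b = y := by
            rw [tsupport, closure_discrete] at hb
            by_contra hne
            exact hb (Set.indicator_of_notMem (s := {y}) hne 1)
          rw [ha', hb']
          exact not_le.1 hxy)
        have h2 : mulOp (pointFun y) (lp.single 2 y (ξ y) : L2 D H) = lp.single 2 y (ξ y) := by
          ext z
          rw [mulOp_apply]
          by_cases hz : z = y
          · subst hz
            simp [pointFun]
          · rw [lp.single_apply_ne _ _ _ hz, smul_zero]
        have h3 := congrArg (fun S : L2 D H →L[ℂ] L2 D H => S (lp.single 2 y (ξ y)) x) h1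
        simp only [mul_apply_eq_comp, h2, mulOp_apply] at h3
        simpa [pointFun] using h3
    have hs := (lp.hasSum_single (by simp) ξ).mapL (lp.evalCLM ℂ (fun _ : D => H) 2 x ∘L T)
    exact (hs.unique (by
      convert hasSum_zero with y
      exact key y))
  · rintro ⟨R, hR, h⟩
    refine ⟨R, hR, fun f g hfg => ?_⟩
    ext ξ x
    simp only [mul_apply_eq_comp, mulOp_apply]
    by_cases hx : f x = 0
    · rw [hx, zero_smul]
      rfl
    · rw [h _ x, smul_zero]
      · rfl
      · intro y hy
        rw [mulOp_apply]
        by_cases hgy : g y = 0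
        · rw [hgy, zero_smul]
        · exact absurd (hfg x (subset_tsupport _ hx) y (subset_tsupport _ hgy)) (not_lt.2 hy)

theorem HasFinitePropagation.star {D : Type*} [MetricSpace D] {H : Type*}
    [NormedAddCommGroup H] [InnerProductSpace ℂ H] [CompleteSpace H] {T : L2 D H →L[ℂ] L2 D H}
    (hT : HasFinitePropagation T) : HasFinitePropagation (star T) := by
  obtain ⟨R, hR, h⟩ := hT
  have hsupp : ∀ f : C₀(D, ℂ), tsupport (Star.star f : C₀(D, ℂ)) = tsupport f := by
    intro f
    rw [tsupport, tsupport]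
    congr 1
    ext x
    simp
  refine ⟨R, hR, fun f g hfg => ?_⟩
  have h1 := h (Star.star g) (Star.star f) (by
    intro x hx y hy
    rw [hsupp] at hx hy
    rw [dist_comm]
    exact hfg y hy x hx)
  have h2 := congrArg Star.star h1
  rw [star_mul, star_mul, mulOp_adjoint, mulOp_adjoint, star_star, star_star, star_zero,
    ← mul_assoc] at h2
  exact h2

theorem IsLocallyCompactOp.star {D : Type*} [MetricSpace D] {H : Type*}
    [NormedAddCommGroup H] [InnerProductSpace ℂ H] [CompleteSpace H] {T : L2 D H →L[ℂ] L2 D H}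
    (hT : IsLocallyCompactOp T) : IsLocallyCompactOp (star T) := by
  intro f
  have h := hT (Star.star f)
  have e1 : Star.star T * mulOp f = Star.star (mulOp (Star.star f) * T) := by
    rw [star_mul, mulOp_adjoint, star_star]
  have e2 : mulOp f * Star.star T = Star.star (T * mulOp (Star.star f)) := by
    rw [star_mul, mulOp_adjoint, star_star]
  rw [e1, e2]
  exact ⟨isCompactOperator_adjoint h.2, isCompactOperator_adjoint h.1⟩

/-- The `*`-algebra of locally compact operators of finite propagation on `ℓ²(D; H)`. -/
noncomputable def algebraicRoe (D : Type*) [MetricSpace D] [DiscreteTopology D] (H : Type*)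
    [NormedAddCommGroup H] [InnerProductSpace ℂ H] [CompleteSpace H] :
    NonUnitalStarSubalgebra ℂ (L2 D H →L[ℂ] L2 D H) where
  carrier := {T | IsLocallyCompactOp T ∧ HasFinitePropagation T}
  zero_mem' := by
    refine ⟨fun f => ?_, 1, one_pos, fun f g _ => by simp⟩
    rw [zero_mul, mul_zero]
    exact ⟨isCompactOperator_zero, isCompactOperator_zero⟩
  add_mem' := by
    rintro S T ⟨hS, hS'⟩ ⟨hT, hT'⟩
    refine ⟨fun f => ?_, ?_⟩
    · rw [add_mul, mul_add]
      exact ⟨(hS f).1.add (hT f).1, (hS f).2.add (hT f).2⟩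
    · obtain ⟨R, hR, h⟩ := hS'
      obtain ⟨R', hR', h'⟩ := hT'
      refine ⟨max R R', lt_max_of_lt_left hR, fun f g hfg => ?_⟩
      rw [mul_add, add_mul, h f g fun x hx y hy => (le_max_left _ _).trans_lt (hfg x hx y hy),
        h' f g fun x hx y hy => (le_max_right _ _).trans_lt (hfg x hx y hy), add_zero]
  smul_mem' := by
    rintro c T ⟨hT, hT'⟩
    refine ⟨fun f => ?_, ?_⟩
    · rw [smul_mul_assoc, mul_smul_comm]
      exact ⟨(hT f).1.smul c, (hT f).2.smul c⟩
    · obtain ⟨R, hR, h⟩ := hT'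
      refine ⟨R, hR, fun f g hfg => ?_⟩
      rw [mul_smul_comm, smul_mul_assoc, h f g hfg, smul_zero]
  mul_mem' := by
    rintro S T ⟨hS, hS'⟩ ⟨hT, hT'⟩
    refine ⟨fun f => ?_, ?_⟩
    · rw [mul_assoc, ← mul_assoc (mulOp f)]
      exact ⟨(hT f).1.clm_comp S, (hS f).2.comp_clm T⟩
    · rw [finitePropagation_iff] at hS' hT' ⊢
      obtain ⟨R, hR, h⟩ := hS'
      obtain ⟨R', hR', h'⟩ := hT'
      refine ⟨R + R', add_pos hR hR', fun ξ x hξ => ?_⟩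
      refine h (T ξ) x fun y hy => h' ξ y fun z hz => hξ z ?_
      exact (dist_triangle x y z).trans (add_le_add hy hz)
  star_mem' := fun h => ⟨h.1.star, h.2.star⟩

/-- The Roe algebra `C*_H(D)`: the norm closure in the bounded operators on `ℓ²(D) ⊗ H` of the
locally compact operators of finite propagation. For `H = ℂ` this is the uniform Roe algebra. -/
noncomputable def roeAlgebra (D : Type*) [MetricSpace D] [DiscreteTopology D] (H : Type*)
    [NormedAddCommGroup H] [InnerProductSpace ℂ H] [CompleteSpace H] :
    NonUnitalStarSubalgebra ℂ (L2 D H →L[ℂ] L2 D H) :=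
  (algebraicRoe D H).topologicalClosure

theorem opNorm_le_of_pointwise {D : Type*} {c : ℝ} (hc : 0 ≤ c) (A : L2 D ℂ →L[ℂ] L2 D ℂ)
    (hA : ∀ (ξ : L2 D ℂ) (x : D), ‖A ξ x‖ ≤ c * ‖ξ x‖) : ‖A‖ ≤ c := by
  refine A.opNorm_le_bound hc fun ξ => ?_
  refine lp.norm_le_of_forall_sum_le (by simp) (by positivity) fun s => ?_
  calc ∑ i ∈ s, ‖A ξ i‖ ^ (2 : ENNReal).toReal
      ≤ ∑ i ∈ s, c ^ (2 : ENNReal).toReal * ‖ξ i‖ ^ (2 : ENNReal).toReal := by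
        refine Finset.sum_le_sum fun i _ => ?_
        rw [← Real.mul_rpow hc (norm_nonneg _)]
        exact Real.rpow_le_rpow (norm_nonneg _) (hA ξ i) (by simp)
    _ ≤ (c * ‖ξ‖) ^ (2 : ENNReal).toReal := by
        rw [← Finset.mul_sum, Real.mul_rpow hc (norm_nonneg _)]
        gcongr
        exact lp.sum_rpow_le_norm_rpow (by simp) ξ s

theorem isCompactOperator_mulOp {D : Type*} [MetricSpace D] [DiscreteTopology D] (f : C₀(D, ℂ)) :
    IsCompactOperator (mulOp f : L2 D ℂ →L[ℂ] L2 D ℂ) := by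
  classical
  have hcl := isClosed_setOfPred_isCompactOperator (𝕜₁ := ℂ) (𝕜₂ := ℂ) (σ₁₂ := RingHom.id ℂ)
    (M₁ := L2 D ℂ) (M₂ := L2 D ℂ)
  refine hcl.closure_subset (Metric.mem_closure_iff.2 fun ε hε => ?_)
  have hfin : {x | ε / 2 ≤ ‖f x‖}.Finite := by
    have h := (zero_at_infty f).eventually (Metric.ball_mem_nhds 0 (half_pos hε))
    rw [Filter.Eventually, Filter.mem_cocompact] at h
    obtain ⟨K, hK, hKs⟩ := h
    refine hK.finite_of_discrete.subset fun x hx => ?_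
    by_contra hxK
    have := hKs hxK
    simp only [dist_zero_right, Set.mem_ofPred_eq] at this hx
    linarith
  let P : D → (L2 D ℂ →L[ℂ] L2 D ℂ) := fun x =>
    lp.singleContinuousLinearMap ℂ (fun _ : D => ℂ) 2 x ∘L lp.evalCLM ℂ (fun _ : D => ℂ) 2 x
  have hP : ∀ x, IsCompactOperator (P x) := fun x =>
    (isCompactOperator_of_locallyCompactSpace_rng
      (lp.singleContinuousLinearMap ℂ (fun _ : D => ℂ) 2 x)).comp_clm
      (lp.evalCLM ℂ (fun _ : D => ℂ) 2 x)
  refine ⟨∑ x ∈ hfin.toFinset, f x • P x, ?_, ?_⟩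
  · exact Submodule.sum_mem (compactOperator (RingHom.id ℂ) (L2 D ℂ) (L2 D ℂ))
      fun x _ => Submodule.smul_mem _ _ (hP x)
  · rw [dist_eq_norm]
    refine (opNorm_le_of_pointwise (half_pos hε).le _ fun ξ x => ?_).trans_lt (half_lt_self hε)
    have hval : (∑ y ∈ hfin.toFinset, f y • P y) ξ x =
        if x ∈ hfin.toFinset then f x • ξ x else 0 := by
      rw [sum_apply, lp.coeFn_sum, Finset.sum_apply]
      have : ∀ y, ((f y • P y) ξ) x = if x = y then f x • ξ x else 0 := by
        intro y
        change f y • (lp.single 2 y (ξ y) : L2 D ℂ) x = _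
        split_ifs with hxy
        · subst hxy
          simp
        · rw [lp.single_apply_ne _ _ _ hxy, smul_zero]
      rw [Finset.sum_congr rfl fun y _ => this y, Finset.sum_ite_eq]
    change ‖mulOp f ξ x - (∑ y ∈ hfin.toFinset, f y • P y) ξ x‖ ≤ _
    rw [hval, mulOp_apply]
    split_ifs with hx
    · simp only [sub_self, norm_zero]
      positivity
    · rw [sub_zero, norm_smul]
      have : ‖f x‖ < ε / 2 := by simpa using hx
      gcongr

/-- The unit `1` of the uniform Roe algebra `C*_ℂ(D)`: the identity operator of `ℓ²(D)`. -/
noncomputable def roeUnit (D : Type*) [MetricSpace D] [DiscreteTopology D] : roeAlgebra D ℂ :=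
  ⟨1, NonUnitalStarSubalgebra.le_topologicalClosure _ ⟨fun f => by
      rw [one_mul, mul_one]
      exact ⟨isCompactOperator_mulOp f, isCompactOperator_mulOp f⟩,
    (finitePropagation_iff _).2 ⟨1, one_pos, fun ξ x h => h x (by simp)⟩⟩⟩

theorem isStarProjection_roeUnit (D : Type*) [MetricSpace D] [DiscreteTopology D] :
    IsStarProjection (roeUnit D) :=
  ⟨Subtype.ext (one_mul (1 : L2 D ℂ →L[ℂ] L2 D ℂ)),
    Subtype.ext (star_one (L2 D ℂ →L[ℂ] L2 D ℂ))⟩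

/-- The isometry `V_D = id ⊗ V : ℓ²(D) → ℓ²(D) ⊗ H` for an isometry `V : ℂ → H`. -/
noncomputable def ampl (D : Type*) {H : Type*} [NormedAddCommGroup H] [InnerProductSpace ℂ H]
    (V : ℂ →ₗᵢ[ℂ] H) : L2 D ℂ →L[ℂ] L2 D H :=
  lp.mapCLM 2 (fun _ => V.toContinuousLinearMap) zero_le_one
    (fun _ => V.norm_toContinuousLinearMap_le)

@[simp]
theorem ampl_apply {D : Type*} {H : Type*} [NormedAddCommGroup H] [InnerProductSpace ℂ H]
    (V : ℂ →ₗᵢ[ℂ] H) (ξ : L2 D ℂ) (x : D) : ampl D V ξ x = V (ξ x) := rfl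

theorem ampl_adjoint_comp {D : Type*} {H : Type*} [NormedAddCommGroup H] [InnerProductSpace ℂ H]
    [CompleteSpace H] (V : ℂ →ₗᵢ[ℂ] H) :
    ContinuousLinearMap.adjoint (ampl D V) ∘L ampl D V = 1 := by
  refine ContinuousLinearMap.ext fun ξ => ext_inner_left ℂ fun η => ?_
  rw [ContinuousLinearMap.comp_apply, ContinuousLinearMap.adjoint_inner_right,
    lp.inner_eq_tsum, one_apply_eq_self, lp.inner_eq_tsum]
  exact tsum_congr fun x => V.inner_map_map _ _

theorem mulOp_ampl {D : Type*} [MetricSpace D] {H : Type*} [NormedAddCommGroup H]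
    [InnerProductSpace ℂ H] (V : ℂ →ₗᵢ[ℂ] H) (f : C₀(D, ℂ)) :
    mulOp f ∘L ampl D V = ampl D V ∘L mulOp f := by
  ext ξ x
  exact ((V.map_smul (f x) (ξ x)).symm :)

theorem ampl_adjoint_mulOp {D : Type*} [MetricSpace D] {H : Type*} [NormedAddCommGroup H]
    [InnerProductSpace ℂ H] [CompleteSpace H] (V : ℂ →ₗᵢ[ℂ] H) (f : C₀(D, ℂ)) :
    ContinuousLinearMap.adjoint (ampl D V) ∘L mulOp f =
      mulOp f ∘L ContinuousLinearMap.adjoint (ampl D V) := by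
  have h := congrArg ContinuousLinearMap.adjoint (mulOp_ampl V (star f))
  rw [ContinuousLinearMap.adjoint_comp, ContinuousLinearMap.adjoint_comp,
    ← ContinuousLinearMap.star_eq_adjoint (mulOp (star f) : L2 D H →L[ℂ] L2 D H),
    ← ContinuousLinearMap.star_eq_adjoint (mulOp (star f) : L2 D ℂ →L[ℂ] L2 D ℂ),
    mulOp_adjoint, mulOp_adjoint, star_star] at h
  exact h

/-- The `*`-homomorphism `T ↦ V_D T V_D*` on all bounded operators. -/
noncomputable def conjAmpl (D : Type*) {H : Type*} [NormedAddCommGroup H] [InnerProductSpace ℂ H]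
    [CompleteSpace H] (V : ℂ →ₗᵢ[ℂ] H) :
    (L2 D ℂ →L[ℂ] L2 D ℂ) →⋆ₙₐ[ℂ] (L2 D H →L[ℂ] L2 D H) where
  toFun T := ampl D V ∘L T ∘L ContinuousLinearMap.adjoint (ampl D V)
  map_smul' c T := by simp
  map_zero' := by simp
  map_add' S T := by simp
  map_mul' S T := by
    have h := fun η : L2 D ℂ => DFunLike.congr_fun (ampl_adjoint_comp (D := D) V) η
    ext1 ξ
    simp only [mul_apply_eq_comp, ContinuousLinearMap.comp_apply,
      one_apply_eq_self] at h ⊢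
    rw [h]
  map_star' T := by
    simp [ContinuousLinearMap.star_eq_adjoint, ContinuousLinearMap.adjoint_comp,
      ContinuousLinearMap.comp_assoc]

theorem conjAmpl_mem {D : Type*} [MetricSpace D] [DiscreteTopology D] {H : Type*}
    [NormedAddCommGroup H] [InnerProductSpace ℂ H] [CompleteSpace H] (V : ℂ →ₗᵢ[ℂ] H)
    {T : L2 D ℂ →L[ℂ] L2 D ℂ} (hT : T ∈ roeAlgebra D ℂ) : conjAmpl D V T ∈ roeAlgebra D H := by
  have hcont : Continuous (conjAmpl D V) :=
    continuous_const.clm_comp (continuous_id.clm_comp continuous_const)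
  refine map_mem_closure hcont hT ?_
  rintro S ⟨hS, R, hR, h⟩
  have e1 : ∀ f : C₀(D, ℂ), conjAmpl D V S * mulOp f = conjAmpl D V (S * mulOp f) := by
    intro f
    change ampl D V ∘L S ∘L (ContinuousLinearMap.adjoint (ampl D V) ∘L mulOp f) = _
    rw [ampl_adjoint_mulOp]
    rfl
  have e2 : ∀ (f : C₀(D, ℂ)) (A : L2 D ℂ →L[ℂ] L2 D ℂ),
      mulOp f * conjAmpl D V A = conjAmpl D V (mulOp f * A) := by
    intro f A
    change (mulOp f ∘L ampl D V) ∘L A ∘L ContinuousLinearMap.adjoint (ampl D V) = _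
    rw [mulOp_ampl]
    rfl
  refine ⟨fun f => ?_, R, hR, fun f g hfg => ?_⟩
  · rw [e1, e2]
    exact ⟨((hS f).1.comp_clm _).clm_comp (ampl D V), ((hS f).2.comp_clm _).clm_comp (ampl D V)⟩
  · rw [mul_assoc, e1, e2, ← mul_assoc, h f g hfg, map_zero]

/-- The `*`-homomorphism `i_D : C*_ℂ(D) → C*_H(D)`, `T ↦ V_D T V_D*`. -/
noncomputable def roeInclusion (D : Type*) [MetricSpace D] [DiscreteTopology D] {H : Type*}
    [NormedAddCommGroup H] [InnerProductSpace ℂ H] [CompleteSpace H] (V : ℂ →ₗᵢ[ℂ] H) :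
    roeAlgebra D ℂ →⋆ₙₐ[ℂ] roeAlgebra D H :=
  NonUnitalStarAlgHom.codRestrict
    ((conjAmpl D V).comp (NonUnitalStarSubalgebraClass.subtype (roeAlgebra D ℂ)))
    (roeAlgebra D H) (fun T => conjAmpl_mem V T.2)

end Roe

end CoarseK

/-
Eilenberg swindle. Choose from each `x` a ray `x = t (x, 0), t (x, 1), …` in `D` with uniformly
bounded steps, such that all the rays together visit each point finitely often. Labels `l (x, n)`
that separate the visits to each point make the vectors `δ_{t (x, n)} ⊗ e_{l (x, n)}` orthonormal,
and the shift `(x, n) ↦ (x, n + 1)` along the rays gives a partial isometry `v` of the Roe algebra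
with `v* v = p + v v*`, where `p = V_D V_D*` is the projection onto the starting vectors. Hence
`[p] = 0`.

The second condition supplies the rays directly, after projecting them to the coarsely dense
subspace `D`. Under the first one, root every component of `D(α)`. The geodesic cone of `x` consists
of the points that have a geodesic to the root passing through `x`. Iterating a map that goes from a
finite cone towards the root and from an infinite one outwards into an infinite subcone is
finite-to-one: pairs (cone size, distance from the root) increase lexicographically along the map,
so by well-foundedness every point has only finitely many predecessors.
-/

namespace CoarseK

section KTheory

theorem MvN.fromBlocks_add {A n : Type*} [Ring A] [StarRing A] [Fintype n] {p q : Matrix n n A}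
    (hp : IsStarProjection p) (hq : IsStarProjection q) (hpq : p * q = 0) :
    MvN (Matrix.fromBlocks p 0 0 q) (p + q) := by
  have hp' : pᴴ = p := hp.isSelfAdjoint
  have hq' : qᴴ = q := hq.isSelfAdjoint
  have hqp : q * p = 0 := by simpa [hp', hq'] using congrArg Matrix.conjTranspose hpq
  refine ⟨Matrix.fromCols p q, ?_, ?_⟩
  · rw [Matrix.conjTranspose_fromCols_eq_fromRows_conjTranspose, Matrix.fromRows_mul_fromCols,
      hp', hq', hp.isIdempotentElem.eq, hq.isIdempotentElem.eq, hpq, hqp]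
  · rw [Matrix.conjTranspose_fromCols_eq_fromRows_conjTranspose, Matrix.fromCols_mul_fromRows,
      hp', hq', hp.isIdempotentElem.eq, hq.isIdempotentElem.eq]

variable {A B : Type*} [NonUnitalRing A] [StarRing A] [Module ℂ A] [IsScalarTower ℂ A A]
  [SMulCommClass ℂ A A] [StarModule ℂ A] [NonUnitalRing B] [StarRing B] [Module ℂ B]
  [IsScalarTower ℂ B B] [SMulCommClass ℂ B B] [StarModule ℂ B]

theorem MatProj.map_ofProj (φ : A →⋆ₙₐ[ℂ] B) {p : A} (hp : IsStarProjection p) :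
    (MatProj.ofProj p hp).map (Unitization.starMap φ) = MatProj.ofProj (φ p) (hp.map φ) := by
  simp only [MatProj.map, MatProj.ofProj]
  congr 1
  exact Matrix.ext fun _ _ => Unitization.starMap_inr φ p

theorem K0.map_cls (φ : A →⋆ₙₐ[ℂ] B) {p : A} (hp : IsStarProjection p) :
    K0.map φ (K0.cls p hp) = K0.cls (φ p) (hp.map φ) := by
  refine Subtype.ext ((K00.map_of _ _).trans ?_)
  exact congrArg (fun P => Algebra.GrothendieckAddGroup.of (VMon.mk P)) (MatProj.map_ofProj φ hp)

theorem K0.cls_add {p q : A} (hp : IsStarProjection p) (hq : IsStarProjection q)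
    (hpq : p * q = 0) : K0.cls (p + q) (hp.add hq hpq) = K0.cls p hp + K0.cls q hq := by
  refine Subtype.ext (Eq.trans (congrArg Algebra.GrothendieckAddGroup.of (VMon.sound ?_))
    (map_add Algebra.GrothendieckAddGroup.of (VMon.mk (.ofProj p hp)) (VMon.mk (.ofProj q hq))))
  let P : Matrix (Fin 1) (Fin 1) (Unitization ℂ A) := (MatProj.ofProj p hp).mat
  let Q : Matrix (Fin 1) (Fin 1) (Unitization ℂ A) := (MatProj.ofProj q hq).mat
  have hPQ : P * Q = 0 := by
    refine Matrix.ext fun _ _ => ?_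
    simp [P, Q, MatProj.ofProj, Matrix.mul_apply, ← Unitization.inr_mul, hpq]
  have hadd : (MatProj.ofProj (p + q) (hp.add hq hpq)).mat = P + Q :=
    Matrix.ext fun _ _ => Unitization.inr_add ℂ p q
  have hblocks : MvN (Matrix.fromBlocks P 0 0 Q) (P + Q) :=
    .fromBlocks_add (MatProj.isProj _) (MatProj.isProj _) hPQ
  exact .trans (MatProj.isProj _) (MatProj.isProj _) (hadd ▸ hblocks.symm) (MatProj.sum_mvn _ _)

theorem K0.cls_eq_of_mvn {p q v : A} (hp : IsStarProjection p) (hq : IsStarProjection q)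
    (hvp : star v * v = p) (hvq : v * star v = q) : K0.cls p hp = K0.cls q hq := by
  let W : Matrix (Fin 1) (Fin 1) (Unitization ℂ A) := Matrix.of fun _ _ => (v : Unitization ℂ A)
  have hWp : Wᴴ * W = Matrix.of fun _ _ => (p : Unitization ℂ A) := by
    refine Matrix.ext fun _ _ => ?_
    simp [W, Matrix.mul_apply, ← hvp]
  have hWq : W * Wᴴ = Matrix.of fun _ _ => (q : Unitization ℂ A) := by
    refine Matrix.ext fun _ _ => ?_
    simp [W, Matrix.mul_apply, ← hvq]
  exact Subtype.ext (congrArg Algebra.GrothendieckAddGroup.of (VMon.sound ⟨W, hWp, hWq⟩))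

theorem K0.cls_eq_zero_of_star_mul_self_eq_add {p v : A} (hp : IsStarProjection p)
    (hv : v * star v * v = v) (hpv : star v * v = p + v * star v) : K0.cls p hp = 0 := by
  have : IsAddTorsionFree A := .of_isTorsionFree ℂ A
  have hq : IsStarProjection (v * star v) :=
    ⟨by rw [IsIdempotentElem, ← mul_assoc, hv], .mul_star_self v⟩
  have hsum : IsIdempotentElem (p + v * star v) := by
    rw [← hpv, IsIdempotentElem, mul_assoc, ← mul_assoc v, hv]
  have horth : p * (v * star v) = 0 := hp.isIdempotentElem.mul_eq_zero_of_anticommute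
    ((IsIdempotentElem.add_iff hp.isIdempotentElem hq.isIdempotentElem).1 hsum)
  have hcls := K0.cls_eq_of_mvn (hp.add hq horth) hq hpv rfl
  rwa [K0.cls_add hp hq horth, add_eq_right] at hcls

end KTheory

section Rays

theorem finite_setOf_iterate_eq {X α : Type*} [LT α] [WellFoundedLT α] {f : X → X} (rank : X → α)
    (hrank : ∀ x, rank x < rank (f x)) (hf : ∀ y, (f ⁻¹' {y}).Finite) (y : X) :
    {z : X × ℕ | f^[z.2] z.1 = y}.Finite := by
  induction y using (InvImage.wf rank wellFounded_lt).induction with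
  | _ y ih =>
    have ih' : ∀ w ∈ f ⁻¹' {y}, {z : X × ℕ | f^[z.2] z.1 = w}.Finite := by
      rintro w rfl
      exact ih w (hrank w)
    refine (((hf y).biUnion ih').image (Prod.map id Nat.succ) |>.insert (y, 0)).subset ?_
    rintro ⟨x, _ | n⟩ h
    · exact .inl (Prod.ext h rfl)
    · rw [Set.mem_ofPred_eq, Function.iterate_succ_apply'] at h
      exact .inr ⟨(x, n), Set.mem_biUnion h rfl, rfl⟩

section Graph

variable {X : Type*} {G : SimpleGraph X} {r w x y z : X}

theorem exists_adj_dist_add_one_eq (h : G.Reachable x y) (hne : x ≠ y) :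
    ∃ w, G.Adj x w ∧ G.dist w y + 1 = G.dist x y := by
  obtain ⟨p, hp⟩ := h.exists_walk_length_eq_dist
  cases p with
  | nil => exact absurd rfl hne
  | @cons _ w _ hadj q =>
    refine ⟨w, hadj, ?_⟩
    have hwy : G.dist w y ≤ q.length := SimpleGraph.dist_le q
    have hxy := hadj.reachable.dist_triangle_left y
    rw [SimpleGraph.dist_eq_one_iff_adj.2 hadj] at hxy
    rw [SimpleGraph.Walk.length_cons] at hp
    lia

/-- The vertices that some geodesic from the root `r` reaches by way of `y`. Reachability is part
of the definition because `SimpleGraph.dist` vanishes between different components. -/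
def geodesicCone (G : SimpleGraph X) (r y : X) : Set X :=
  {x | G.Reachable y x ∧ G.dist r x = G.dist r y + G.dist y x}

theorem self_mem_geodesicCone (G : SimpleGraph X) (r y : X) : y ∈ geodesicCone G r y :=
  ⟨.refl y, by simp⟩

theorem geodesicCone_ssubset (hr : G.Reachable r w) (hadj : G.Adj w x)
    (hdist : G.dist r w + 1 = G.dist r x) : geodesicCone G r x ⊂ geodesicCone G r w := by
  have hwx : G.dist w x = 1 := SimpleGraph.dist_eq_one_iff_adj.2 hadj
  refine ⟨fun z ⟨hxz, hz⟩ => ⟨hadj.reachable.trans hxz, ?_⟩, fun h => ?_⟩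
  · have := hadj.reachable.dist_triangle_left z
    have := hr.dist_triangle_left z
    lia
  · have := (h (self_mem_geodesicCone G r w)).2
    lia

theorem geodesicCone_subset_insert_biUnion (hr : G.Reachable r x) :
    geodesicCone G r x ⊆
      insert x (⋃ y ∈ {y ∈ G.neighborSet x | G.dist r x < G.dist r y}, geodesicCone G r y) := by
  intro z ⟨hxz, hz⟩
  by_cases hne : x = z
  · exact .inl hne.symm
  obtain ⟨y, hadj, hyz⟩ := exists_adj_dist_add_one_eq hxz hne
  have hxy : G.dist x y = 1 := SimpleGraph.dist_eq_one_iff_adj.2 hadj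
  have := hr.dist_triangle_left y
  have := (hr.trans hadj.reachable).dist_triangle_left z
  exact .inr (Set.mem_biUnion (x := y) ⟨hadj, by lia⟩ ⟨hadj.symm.reachable.trans hxz, by lia⟩)

/-- The size of the geodesic cone of `x`, with ties broken by the distance of `x` from the root `r`.
Moving to vertices of larger rank means descending towards the root inside finite cones, and
away from the root inside infinite ones. -/
noncomputable def coneRank (G : SimpleGraph X) (r x : X) : ℕ∞ ×ₗ ℕ :=
  toLex ((geodesicCone G r x).encard, G.dist r x)

theorem exists_adj_coneRank_lt (hG : ∀ x, (G.neighborSet x).Finite)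
    (hinf : {y | G.Reachable r y}.Infinite) (hr : G.Reachable r x) :
    ∃ y, G.Adj x y ∧ coneRank G r x < coneRank G r y := by
  by_cases hx : (geodesicCone G r x).Finite
  · have hne : x ≠ r := by
      rintro rfl
      exact hinf (hx.subset fun y hy => ⟨hy, by simp⟩)
    obtain ⟨w, hadj, hw⟩ := exists_adj_dist_add_one_eq hr.symm hne
    rw [G.dist_comm, G.dist_comm (u := x)] at hw
    have hss := geodesicCone_ssubset (hr.trans hadj.reachable) hadj.symm hw
    exact ⟨w, hadj, Prod.Lex.toLex_lt_toLex.2 (.inl (hx.encard_lt_encard hss))⟩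
  · obtain ⟨y, ⟨hadj, hlt⟩, hy⟩ : ∃ y ∈ {y ∈ G.neighborSet x | G.dist r x < G.dist r y},
        ¬ (geodesicCone G r y).Finite := by
      by_contra! h
      exact hx ((((hG x).sep _).biUnion h).insert x |>.subset
        (geodesicCone_subset_insert_biUnion hr))
    refine ⟨y, hadj, Prod.Lex.toLex_lt_toLex.2 (.inr ⟨?_, hlt⟩)⟩
    exact (Set.Infinite.encard_eq hx).trans (Set.Infinite.encard_eq hy).symm

theorem exists_adj_forall_finite_setOf_iterate_eq (hG : ∀ x, (G.neighborSet x).Finite)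
    (hinf : ∀ c : G.ConnectedComponent, c.supp.Infinite) :
    ∃ f : X → X, (∀ x, G.Adj x (f x)) ∧ ∀ y, {z : X × ℕ | f^[z.2] z.1 = y}.Finite := by
  let root (x : X) : X := (G.connectedComponentMk x).out
  have hroot (x : X) : G.Reachable (root x) x :=
    SimpleGraph.ConnectedComponent.exact (Quot.out_eq (G.connectedComponentMk x))
  have hroot_adj {x y : X} (h : G.Adj x y) : root x = root y :=
    congrArg Quot.out (SimpleGraph.ConnectedComponent.sound h.reachable)
  have hnext (x : X) : ∃ y, G.Adj x y ∧ coneRank G (root x) x < coneRank G (root x) y := by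
    refine exists_adj_coneRank_lt hG ((hinf (G.connectedComponentMk x)).mono fun y hy => ?_)
      (hroot x)
    exact (hroot x).trans (SimpleGraph.ConnectedComponent.exact hy).symm
  choose f hadj hlt using hnext
  refine ⟨f, hadj, finite_setOf_iterate_eq (fun x => coneRank G (root x) x) (fun x => ?_)
    fun y => (hG y).subset ?_⟩
  · exact hroot_adj (hadj x) ▸ hlt x
  · rintro x rfl
    exact (hadj x).symm

end Graph

/-- From every point `x` there is a ray `t (x, 0) = x, t (x, 1), …` with uniformly bounded steps,
and only finitely many of these rays pass, finitely often, through a given point. -/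
def HasProperRays (D : Type*) [MetricSpace D] : Prop :=
  ∃ (t : D × ℕ → D) (R : ℝ), (∀ x, t (x, 0) = x) ∧
    (∀ x n, dist (t (x, n)) (t (x, n + 1)) ≤ R) ∧ ∀ y, (t ⁻¹' {y}).Finite

theorem NoFiniteComponents.hasProperRays {D : Type*} [MetricSpace D] (hD : NoFiniteComponents D)
    (hbg : BoundedGeometry D) : HasProperRays D := by
  obtain ⟨α, hα, hinf⟩ := hD
  obtain ⟨N, hN⟩ := hbg α hα
  have hfin (x : D) : ((ripsGraph D α).neighborSet x).Finite :=
    (Set.finite_of_encard_le_coe (hN x)).subset fun y hy =>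
      Metric.mem_closedBall'.2 hy.2
  obtain ⟨f, hadj, hfibre⟩ := exists_adj_forall_finite_setOf_iterate_eq hfin hinf
  refine ⟨fun z => f^[z.2] z.1, α, fun x => rfl, fun x n => ?_, hfibre⟩
  simp only [Function.iterate_succ_apply']
  exact (hadj _).2

theorem HasRayStructure.hasProperRays {D : Type*} [MetricSpace D] (hD : HasRayStructure D) :
    HasProperRays D := by
  obtain ⟨I, S, β, hcover, hdisj, hbij, L, hL⟩ := hD
  choose ray hray using fun x => Set.mem_iUnion.1 (hcover.symm ▸ Set.mem_univ x)
  choose pos hpos using fun x => (hbij (ray x)).surjOn (hray x)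
  have hpos' (x : D) : β (ray x) (pos x) = x := (hpos x).2
  have hray_eq {x : D} {i : I} {n : ℕ} (h : β i n = x) : i = ray x := by
    by_contra hne
    exact (hdisj hne).le_bot ⟨h ▸ (hbij i).mapsTo (Set.mem_univ n), hray x⟩
  refine ⟨fun z => β (ray z.1) (pos z.1 + z.2), L, hpos', fun x n => ?_, fun y => ?_⟩
  · simpa [Nat.dist_eq] using (hL (ray x)).dist_le_mul (pos x + n) (pos x + (n + 1))
  · refine Set.Finite.subset (((Set.finite_Iic (pos y)).prod (Set.finite_Iic (pos y))).image
      fun k : ℕ × ℕ => (β (ray y) k.1, k.2)) ?_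
    rintro ⟨x, n⟩ (hy : β (ray x) (pos x + n) = y)
    have hxy : ray x = ray y := hray_eq hy
    have hsum : pos x + n = pos y := (hbij (ray y)).injOn (Set.mem_univ _) (Set.mem_univ _)
      (by rw [hpos' y, ← hxy, hy])
    refine ⟨(pos x, n), ⟨Set.mem_Iic.2 (by lia), Set.mem_Iic.2 (by lia)⟩, ?_⟩
    exact Prod.ext ((congrArg (β · (pos x)) hxy.symm).trans (hpos' x)) rfl

theorem HasProperRays.of_isometry {D D' : Type*} [MetricSpace D] [MetricSpace D']
    [DiscreteTopology D'] [ProperSpace D'] (h : HasProperRays D') {j : D → D'} (hj : Isometry j)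
    {C : ℝ} (hC : ∀ x, ∃ y, dist x (j y) < C) : HasProperRays D := by
  obtain ⟨t, R, ht0, htR, hfibre⟩ := h
  have hretract (x : D') : ∃ y, dist x (j y) < C ∧ ∀ z, j z = x → y = z := by
    obtain ⟨y, hy⟩ := hC x
    by_cases h : ∃ z, j z = x
    · obtain ⟨z, rfl⟩ := h
      exact ⟨z, by simpa using dist_nonneg.trans_lt hy, fun _ h => (hj.injective h).symm⟩
    · exact ⟨y, hy, fun z hz => (h ⟨z, hz⟩).elim⟩
  choose c hc hcj using hretract
  have hc_fibre (y : D) : (c ⁻¹' {y}).Finite := by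
    refine ((isCompact_closedBall (j y) C).finite_of_discrete).subset ?_
    rintro x rfl
    exact (hc x).le
  refine ⟨fun z => c (t (j z.1, z.2)), C + R + C, fun x => hcj _ x (ht0 _).symm,
    fun x n => ?_, fun y => ?_⟩
  · rw [← hj.dist_eq]
    refine (dist_triangle4 _ (t (j x, n)) (t (j x, n + 1)) _).trans ?_
    exact add_le_add_three (dist_comm _ (j _) ▸ (hc _).le) (htR _ n) (hc _).le
  · have hfin : (t ⁻¹' (c ⁻¹' {y})).Finite := (hc_fibre y).preimage' fun x _ => hfibre x
    exact hfin.preimage (f := Prod.map j id)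
      (hj.injective.prodMap Function.injective_id).injOn

theorem EmbedsInRaySpace.hasProperRays {D : Type*} [MetricSpace D] (hD : EmbedsInRaySpace D) :
    HasProperRays D := by
  obtain ⟨D', _, _, _, hray, j, hj, C, -, hC⟩ := hD
  exact hray.hasProperRays.of_isometry hj hC

end Rays

section Transfer

open scoped ZeroAtInfty ComplexInnerProductSpace
open ContinuousLinearMap

section Family

variable {ι ι₁ ι₂ E : Type*} [NormedAddCommGroup E] [InnerProductSpace ℂ E] [CompleteSpace E]
  {b c d : ι → E}

/-- The isometry of `ℓ²(ι)` onto the closed span of an orthonormal family `b`, which maps the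
standard basis to `b`. -/
noncomputable def familyIsometry (hb : Orthonormal ℂ b) : L2 ι ℂ →L[ℂ] E :=
  hb.orthogonalFamily.linearIsometry.toContinuousLinearMap

theorem hasSum_familyIsometry (hb : Orthonormal ℂ b) (ξ : L2 ι ℂ) :
    HasSum (fun i => ξ i • b i) (familyIsometry hb ξ) :=
  hb.orthogonalFamily.hasSum_linearIsometry ξ

theorem adjoint_familyIsometry_apply (hb : Orthonormal ℂ b) (η : E) (i : ι) :
    adjoint (familyIsometry hb) η i = ⟪b i, η⟫ := by
  classical
  have hsingle : familyIsometry hb (lp.single 2 i (1 : ℂ)) = b i :=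
    (hb.orthogonalFamily.linearIsometry_apply_single _).trans (by simp)
  simpa [adjoint_inner_right, hsingle] using
    (lp.inner_single_left (𝕜 := ℂ) i (1 : ℂ) (adjoint (familyIsometry hb) η)).symm

/-- The partial isometry that maps the orthonormal family `b` to `c` and vanishes on the orthogonal
complement of `b`. -/
noncomputable def transfer (hb : Orthonormal ℂ b) (hc : Orthonormal ℂ c) : E →L[ℂ] E :=
  familyIsometry hc ∘L adjoint (familyIsometry hb)

theorem star_transfer (hb : Orthonormal ℂ b) (hc : Orthonormal ℂ c) :
    star (transfer hb hc) = transfer hc hb := by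
  rw [star_eq_adjoint, transfer, adjoint_comp, adjoint_adjoint, transfer]

theorem transfer_mul_transfer (hb : Orthonormal ℂ b) (hc : Orthonormal ℂ c)
    (hd : Orthonormal ℂ d) : transfer hc hd * transfer hb hc = transfer hb hd := by
  have hcancel : adjoint (familyIsometry hc) ∘L familyIsometry hc = 1 :=
    LinearIsometry.adjoint_comp_self _
  calc transfer hc hd * transfer hb hc
      = familyIsometry hd ∘L (adjoint (familyIsometry hc) ∘L familyIsometry hc) ∘L
          adjoint (familyIsometry hb) := rfl
    _ = transfer hb hd := by rw [hcancel]; rfl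

theorem hasSum_transfer (hb : Orthonormal ℂ b) (hc : Orthonormal ℂ c) (η : E) :
    HasSum (fun i => ⟪b i, η⟫ • c i) (transfer hb hc η) := by
  have h := hasSum_familyIsometry hc (adjoint (familyIsometry hb) η)
  simp only [adjoint_familyIsometry_apply] at h
  exact h

theorem transfer_comp_add_transfer_comp (hb : Orthonormal ℂ b) (hc : Orthonormal ℂ c)
    {f : ι₁ → ι} {g : ι₂ → ι} (hf : f.Injective) (hg : g.Injective)
    (hfg : IsCompl (Set.range f) (Set.range g)) :
    transfer (hb.comp f hf) (hc.comp f hf) + transfer (hb.comp g hg) (hc.comp g hg) =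
      transfer hb hc := by
  ext1 η
  let u : ι → E := fun i => ⟪b i, η⟫ • c i
  have hf_sum := (hf.hasSum_range_iff (f := u)).2
    (hasSum_transfer (hb.comp f hf) (hc.comp f hf) η)
  have hg_sum := (hg.hasSum_range_iff (f := u)).2
    (hasSum_transfer (hb.comp g hg) (hc.comp g hg) η)
  exact (HasSum.add_isCompl (f := u) hfg hf_sum hg_sum).unique (hasSum_transfer hb hc η)

end Family

section Roe

variable {ι D H : Type*} [DecidableEq D] [NormedAddCommGroup H] [InnerProductSpace ℂ H]

theorem orthonormal_single {κ : Type*} {e : κ → H} (he : Orthonormal ℂ e) {s : ι → D} {l : ι → κ}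
    (h : Function.Injective fun i => (s i, l i)) :
    Orthonormal ℂ fun i => (lp.single 2 (s i) (e (l i)) : L2 D H) := by
  classical
  rw [orthonormal_iff_ite] at he ⊢
  intro i j
  rw [lp.inner_single_left]
  by_cases hs : s i = s j
  · rw [hs, lp.single_apply_self, he]
    exact if_congr ⟨fun hl => h (Prod.ext hs hl), fun hij => congrArg l hij⟩ rfl rfl
  · rw [lp.single_apply_ne _ _ _ hs, inner_zero_right, if_neg fun hij => hs (congrArg s hij)]

variable [CompleteSpace H]

theorem ampl_eq_familyIsometry (V : ℂ →ₗᵢ[ℂ] H)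
    (hb : Orthonormal ℂ fun x : D => (lp.single 2 x (V 1) : L2 D H)) :
    ampl D V = familyIsometry hb := by
  ext1 ξ
  refine (lp.hasSum_single (by simp) (ampl D V ξ)).unique ?_
  convert hasSum_familyIsometry hb ξ using 2 with x
  rw [ampl_apply, ← lp.single_smul, ← map_smul, smul_eq_mul, mul_one]

variable [MetricSpace D] [MetricSpace ι] {s s' : CocompactMap ι D} {g g' : ι → H}

theorem mulOp_comp_familyIsometry
    (hb : Orthonormal ℂ fun i => (lp.single 2 (s i) (g i) : L2 D H)) (f : C₀(D, ℂ)) :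
    mulOp f ∘L familyIsometry hb = familyIsometry hb ∘L mulOp (f.comp s) := by
  ext1 ξ
  have hterm (i : ι) : mulOp f (ξ i • lp.single 2 (s i) (g i)) =
      mulOp (f.comp s) ξ i • (lp.single 2 (s i) (g i) : L2 D H) := by
    ext x
    by_cases hx : x = s i
    · subst hx
      simp [smul_smul, mul_comm]
    · simp [hx]
  refine ((hasSum_familyIsometry hb ξ).mapL (mulOp f)).unique ?_
  simp only [hterm]
  exact hasSum_familyIsometry hb (mulOp (f.comp s) ξ)

theorem adjoint_familyIsometry_comp_mulOp
    (hb : Orthonormal ℂ fun i => (lp.single 2 (s i) (g i) : L2 D H)) (f : C₀(D, ℂ)) :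
    adjoint (familyIsometry hb) ∘L mulOp f = mulOp (f.comp s) ∘L adjoint (familyIsometry hb) := by
  have hstar : star ((star f).comp s) = f.comp s := by ext; simp
  have h := congrArg adjoint (mulOp_comp_familyIsometry hb (star f))
  rwa [adjoint_comp, adjoint_comp, ← star_eq_adjoint (mulOp _ : L2 D H →L[ℂ] L2 D H),
    ← star_eq_adjoint (mulOp _ : L2 ι ℂ →L[ℂ] L2 ι ℂ), mulOp_adjoint, mulOp_adjoint, star_star,
    hstar] at h

theorem isLocallyCompactOp_transfer [DiscreteTopology ι]
    (hb : Orthonormal ℂ fun i => (lp.single 2 (s i) (g i) : L2 D H))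
    (hc : Orthonormal ℂ fun i => (lp.single 2 (s' i) (g' i) : L2 D H)) :
    IsLocallyCompactOp (transfer hb hc) := by
  refine fun f => ⟨?_, ?_⟩
  · have h : transfer hb hc * mulOp f =
        familyIsometry hc ∘L mulOp (f.comp s) ∘L adjoint (familyIsometry hb) := by
      rw [← adjoint_familyIsometry_comp_mulOp hb]; rfl
    rw [h]
    exact ((isCompactOperator_mulOp (f.comp s)).comp_clm _).clm_comp (familyIsometry hc)
  · have h : mulOp f * transfer hb hc =
        (familyIsometry hc ∘L mulOp (f.comp s')) ∘L adjoint (familyIsometry hb) := by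
      rw [← mulOp_comp_familyIsometry hc]; rfl
    rw [h]
    exact ((isCompactOperator_mulOp (f.comp s')).clm_comp (familyIsometry hc)).comp_clm _

theorem hasFinitePropagation_transfer
    (hb : Orthonormal ℂ fun i => (lp.single 2 (s i) (g i) : L2 D H))
    (hc : Orthonormal ℂ fun i => (lp.single 2 (s' i) (g' i) : L2 D H)) {R : ℝ}
    (hR : ∀ i, dist (s i) (s' i) ≤ R) : HasFinitePropagation (transfer hb hc) := by
  refine ⟨max R 1, by positivity, fun f₁ f₂ hf => ?_⟩
  have hzero : mulOp (f₁.comp s') ∘L mulOp (f₂.comp s) = (0 : L2 ι ℂ →L[ℂ] L2 ι ℂ) := by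
    ext ξ i
    suffices f₁ (s' i) = 0 ∨ f₂ (s i) = 0 by
      simpa [← mul_assoc] using Or.inl this
    by_contra! h
    refine (hf (s' i) (subset_tsupport _ h.1) (s i) (subset_tsupport _ h.2)).not_ge ?_
    exact (dist_comm (s' i) (s i)).trans_le ((hR i).trans (le_max_left R 1))
  calc mulOp f₁ * transfer hb hc * mulOp f₂
      = (mulOp f₁ ∘L familyIsometry hc) ∘L (adjoint (familyIsometry hb) ∘L mulOp f₂) := rfl
    _ = familyIsometry hc ∘L (mulOp (f₁.comp s') ∘L mulOp (f₂.comp s)) ∘L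
          adjoint (familyIsometry hb) := by
        rw [mulOp_comp_familyIsometry, adjoint_familyIsometry_comp_mulOp]; rfl
    _ = 0 := by rw [hzero, zero_comp, comp_zero]

theorem transfer_mem_roeAlgebra [DiscreteTopology D] [DiscreteTopology ι]
    (hb : Orthonormal ℂ fun i => (lp.single 2 (s i) (g i) : L2 D H))
    (hc : Orthonormal ℂ fun i => (lp.single 2 (s' i) (g' i) : L2 D H)) {R : ℝ}
    (hR : ∀ i, dist (s i) (s' i) ≤ R) : transfer hb hc ∈ roeAlgebra D H :=
  have h : transfer hb hc ∈ algebraicRoe D H :=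
    ⟨isLocallyCompactOp_transfer hb hc, hasFinitePropagation_transfer hb hc hR⟩
  NonUnitalStarSubalgebra.le_topologicalClosure _ h

theorem coe_roeInclusion_roeUnit [DiscreteTopology D] (V : ℂ →ₗᵢ[ℂ] H)
    (hb : Orthonormal ℂ fun x : D => (lp.single 2 x (V 1) : L2 D H)) :
    (roeInclusion D V (roeUnit D) : L2 D H →L[ℂ] L2 D H) = transfer hb hb := by
  change ampl D V ∘L 1 ∘L adjoint (ampl D V) = _
  rw [ampl_eq_familyIsometry V hb]
  rfl

end Roe

end Transfer

theorem exists_orthonormal_sequence {H : Type*} [NormedAddCommGroup H] [InnerProductSpace ℂ H]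
    [CompleteSpace H] (hH : ¬ FiniteDimensional ℂ H) {w : H} (hw : ‖w‖ = 1) :
    ∃ e : ℕ → H, Orthonormal ℂ e ∧ e 0 = w := by
  have hsingleton : Orthonormal ℂ ((↑) : ({w} : Set H) → H) :=
    ⟨fun x => by rw [x.2, hw], fun x y h => absurd (Subsingleton.elim x y) h⟩
  obtain ⟨S, B, hwS, hB⟩ := hsingleton.exists_hilbertBasis_extension
  have : Infinite S := by
    by_contra hfin
    have := not_infinite_iff_finite.1 hfin
    have := Fintype.ofFinite S
    exact hH (Module.Basis.finiteDimensional_of_finite B.toOrthonormalBasis.toBasis)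
  classical
  let n : ℕ ↪ S := Infinite.natEmbedding S
  let w' : S := ⟨w, hwS rfl⟩
  refine ⟨B ∘ Equiv.swap (n 0) w' ∘ n, B.orthonormal.comp _
    ((Equiv.injective _).comp n.injective), ?_⟩
  simp [hB, w']

theorem exists_injective_prodMk_nat {X Y : Type*} {f : X → Y} {A : Set X} (hA : A.InjOn f)
    (hf : ∀ y, (f ⁻¹' {y}).Countable) :
    ∃ l : X → ℕ, (∀ a ∈ A, l a = 0) ∧ Function.Injective fun x => (f x, l x) := by
  classical
  choose m hm using fun y => Set.countable_iff_exists_injOn.1 (hf y)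
  refine ⟨fun x => if x ∈ A then 0 else m (f x) x + 1, fun a ha => if_pos ha, fun x y h => ?_⟩
  obtain ⟨hxy, hl⟩ := Prod.mk.inj h
  by_cases hx : x ∈ A <;> by_cases hy : y ∈ A <;> simp only [hx, hy, if_true, if_false] at hl
  · exact hA hx hy hxy
  · lia
  · lia
  · rw [Nat.add_right_cancel_iff, ← hxy] at hl
    exact hm (f x) rfl hxy.symm hl

theorem exists_cocompactMap {X Y : Type*} [TopologicalSpace X] [DiscreteTopology X]
    [TopologicalSpace Y] [DiscreteTopology Y] {f : X → Y} (hf : ∀ y, (f ⁻¹' {y}).Finite) :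
    ∃ s : CocompactMap X Y, ⇑s = f := by
  refine ⟨⟨⟨f, continuous_of_discreteTopology⟩, ?_⟩, rfl⟩
  rw [Filter.cocompact_eq_cofinite, Filter.cocompact_eq_cofinite]
  exact .cofinite_of_finite_preimage_singleton hf

section Swindle

variable {D H : Type*} [MetricSpace D] [DiscreteTopology D]
  [NormedAddCommGroup H] [InnerProductSpace ℂ H] [CompleteSpace H]

theorem HasProperRays.exists_orthonormal_single [DecidableEq D] (hD : HasProperRays D)
    (hH : ¬ FiniteDimensional ℂ H) {w : H} (hw : ‖w‖ = 1) :
    ∃ (s : CocompactMap (D × ℕ) D) (g : D × ℕ → H) (R : ℝ),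
      (∀ x, s (x, 0) = x) ∧ (∀ x, g (x, 0) = w) ∧
      (∀ z, dist (s z) (s (z.1, z.2 + 1)) ≤ R) ∧
      Orthonormal ℂ fun z => (lp.single 2 (s z) (g z) : L2 D H) := by
  obtain ⟨t, R, ht_zero, ht_dist, ht_finite⟩ := hD
  obtain ⟨s, rfl⟩ := exists_cocompactMap ht_finite
  obtain ⟨e, he, he_zero⟩ := exists_orthonormal_sequence hH hw
  have hs_injOn : {z : D × ℕ | z.2 = 0}.InjOn s := by
    rintro ⟨x, _⟩ rfl ⟨y, _⟩ rfl hxy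
    rw [ht_zero, ht_zero] at hxy
    rw [hxy]
  obtain ⟨l, hl_zero, hl⟩ := exists_injective_prodMk_nat hs_injOn fun y => (ht_finite y).countable
  exact ⟨s, fun z => e (l z), R, ht_zero,
    fun x => (congrArg e (hl_zero (x, 0) rfl)).trans he_zero, fun z => ht_dist z.1 z.2,
    orthonormal_single he hl⟩

theorem isCompl_range_prodMk_zero_range_prodMk_succ (X : Type*) :
    IsCompl (Set.range fun x : X => (x, 0)) (Set.range fun z : X × ℕ => (z.1, z.2 + 1)) := by
  refine ⟨Set.disjoint_left.2 ?_, codisjoint_iff_le_sup.2 ?_⟩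
  · rintro _ ⟨x, rfl⟩ ⟨z, hz⟩
    exact Nat.succ_ne_zero _ (congrArg Prod.snd hz)
  · rintro ⟨x, _ | n⟩ -
    · exact .inl ⟨x, rfl⟩
    · exact .inr ⟨(x, n), rfl⟩

theorem HasProperRays.exists_star_mul_self_eq_add (hD : HasProperRays D)
    (hH : ¬ FiniteDimensional ℂ H) (V : ℂ →ₗᵢ[ℂ] H) :
    ∃ v : roeAlgebra D H, v * star v * v = v ∧
      star v * v = roeInclusion D V (roeUnit D) + v * star v := by
  classical
  obtain ⟨s, g, R, hs_zero, hg_zero, hR, hb⟩ :=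
    hD.exists_orthonormal_single hH ((V.norm_map 1).trans norm_one)
  have hshift : Function.Injective fun z : D × ℕ => (z.1, z.2 + 1) := fun z z' h => by
    simpa [Prod.ext_iff] using h
  obtain ⟨σ, hσ⟩ := exists_cocompactMap fun z => (Set.finite_singleton z).preimage hshift.injOn
  have hbase : Function.Injective fun x : D => (x, 0) := Prod.mk_left_injective 0
  have hV : (fun x : D => (lp.single 2 x (V 1) : L2 D H)) =
      (fun z => lp.single 2 (s z) (g z)) ∘ fun x => (x, 0) := by
    funext x
    simp only [Function.comp_apply, hs_zero, hg_zero]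
  have hunit : (roeInclusion D V (roeUnit D) : L2 D H →L[ℂ] L2 D H) =
      transfer (hb.comp _ hbase) (hb.comp _ hbase) := by
    simp only [← hV]
    exact coe_roeInclusion_roeUnit V _
  have hcompl := isCompl_range_prodMk_zero_range_prodMk_succ D
  rw [← hσ] at hshift hcompl
  have hv : transfer hb (hb.comp σ hshift) ∈ roeAlgebra D H :=
    transfer_mem_roeAlgebra (s' := s.comp σ) hb (hb.comp σ hshift)
      fun z => by simpa [hσ] using hR z
  refine ⟨⟨_, hv⟩, Subtype.ext ?_, Subtype.ext ?_⟩
  · change transfer _ _ * star (transfer _ _) * transfer _ _ = transfer _ _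
    simp only [star_transfer, transfer_mul_transfer]
  · change star (transfer _ _) * transfer _ _ = _ + transfer _ _ * star (transfer _ _)
    simp only [star_transfer, transfer_mul_transfer]
    rw [hunit, transfer_comp_add_transfer_comp hb hb hbase hshift hcompl]

end Swindle

end CoarseK

theorem corollary3p4_general
    (D : Type*) [MetricSpace D] [DiscreteTopology D] (hD : CoarseK.HasProperRays D)
    (H : Type*) [NormedAddCommGroup H] [InnerProductSpace ℂ H] [CompleteSpace H]
    (hH : ¬ FiniteDimensional ℂ H) (V : ℂ →ₗᵢ[ℂ] H) :
    CoarseK.K0.map (CoarseK.roeInclusion D V)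
      (CoarseK.K0.cls (CoarseK.roeUnit D) (CoarseK.isStarProjection_roeUnit D)) = 0 := by
  obtain ⟨v, hv, hpv⟩ := hD.exists_star_mul_self_eq_add hH V
  rw [CoarseK.K0.map_cls]
  exact CoarseK.K0.cls_eq_zero_of_star_mul_self_eq_add _ hv hpv

theorem corollary3p4
    (D : Type*) [MetricSpace D] [CoarseK.UniformlyDiscrete D] (hbg : CoarseK.BoundedGeometry D)
    (hD : CoarseK.NoFiniteComponents D ∨ CoarseK.EmbedsInRaySpace D)
    (H : Type*) [NormedAddCommGroup H] [InnerProductSpace ℂ H] [CompleteSpace H]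
    (hH : ¬ FiniteDimensional ℂ H) (V : ℂ →ₗᵢ[ℂ] H) :
    CoarseK.K0.map (CoarseK.roeInclusion D V)
      (CoarseK.K0.cls (CoarseK.roeUnit D) (CoarseK.isStarProjection_roeUnit D)) = 0 :=
  corollary3p4_general D (hD.elim (·.hasProperRays hbg) (·.hasProperRays)) H hH V
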